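/- Let $0<|q|<1$. Write $(x;q)_\infty=\prod_{n\ge 0}(1-xq^n)$ and, for $n\in\mathbb Z$, $(x;q)_n=(x;q)_\infty/(q^nx;q)_\infty$, that is, $(x;q)_n=\prod_{j=0}^{n-1}(1-xq^j)$ if $n\ge 0$ and $(x;q)_n=1/\prod_{j=1}^{-n}(1-xq^{-j})$ if $n<0$; put $(x_1,\dots,x_m;q)_n=\prod_i (x_i;q)_n$ for $n\in\mathbb Z\cup\{\infty\}$. Let $$\theta(x)=\frac1{(q;q)_\infty}\sum_{n\in\mathbb Z}(-1)^nq^{n(n-1)/2}x^n\quad(x\ne0),\qquad \theta(x_1,\dots,x_m)=\prod_i\theta(x_i),$$ $$\Omega(x_1,\dots,x_n;a_1,\dots,a_m)=\prod_{i=1}^n\prod_{j=1}^m(x_i/a_j;q)_\infty ,$$ and let $${}_8\psi_8[a;a_3,\dots,a_8;q,w]=\sum_{n\in\mathbb Z}\frac{(a_1,\dots,a_8;q)_n}{(aq/a_1,\dots,aq/a_8;q)_n}\,w^n,\qquad a_1=q\sqrt a,\quad a_2=-q\sqrt a,$$ denote the very-well-poised bilateral series. Let $a,b,c,d,e,h,k,x,z$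 be nonzero complex numbers and put $w=\dfrac{a^3q^2}{bcdehk}$, where $|w|<1$. Assume that the terms of the three series below are well defined (that is, for the upper parameters $a_i$ and lower parameters $b_i=Aq/a_i$ of each series with base $A$, $a_i\ne q^{j}$ for $j\ge1$ and $b_i\neq q^{-j}$ for $j\ge 0$), and that no denominator of the three coefficients below vanishes. Then the three series converge absolutely, and $$\begin{aligned} &\frac{\Omega(q,aq;b,c,d,e,h,k)}{\theta(bx/a,xz/a,bx,xz)}\;{}_8\psi_8[a;b,c,d,e,h,k;q,w]\\ &=\frac{(aq,q/a;q)_\infty}{(b^2x^2q/a,\,aq/b^2x^2;q)_\infty}\,\frac{\Omega(aq/bx,bqx;b,c,d,e,h,k)}{\theta(z/b,bx,bx/a,bx^2z/a)}\\ &\qquad\times{}_8\psi_8\Big[\frac{b^2x^2}a;\frac{b^2x}a,\frac{bcx}a,\frac{bdx}a,\frac{bex}a,\frac{bhx}a,\frac{bkx}a;q,w\Big]\\ &\quad+\frac{(aq,q/a;q)_\infty}{(x^2z^2q/a,\,aq/x^2z^2;q)_\infty}\,\frac{\Omega(xzq,aq/xz;b,c,d,e,h,k)}{\theta(b/z,xz/a,bx^2z/a,xz)}\\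 &\qquad\times{}_8\psi_8\Big[\frac{x^2z^2}a;\frac{bxz}a,\frac{cxz}a,\frac{dxz}a,\frac{exz}a,\frac{hxz}a,\frac{kxz}a;q,w\Big]. \end{aligned}$$ -/

import Mathlib

noncomputable section

/-- The infinite `q`-shifted factorial `(x; q)_∞ = ∏_{n ≥ 0} (1 - x q^n)`. -/
def qInf (q x : ℂ) : ℂ := ∏' n : ℕ, (1 - x * q ^ n)

/-- `(x₁, …, x_m; q)_∞ = (x₁; q)_∞ ⋯ (x_m; q)_∞`. -/
def qInfList (q : ℂ) (xs : List ℂ) : ℂ := (xs.map (qInf q)).prod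

/-- The `q`-shifted factorial `(x; q)_n` for an integer `n`:
`∏_{0 ≤ j < n} (1 - x q^j)` if `n ≥ 0` and `1 / ∏_{1 ≤ j ≤ -n} (1 - x q^{-j})` if `n < 0`.
It equals `(x; q)_∞ / (q^n x; q)_∞` whenever the latter is meaningful (`qPoch_eq_div`), and it
also covers the terminating case `x = q^{-m}`, where that quotient reads `0 / 0`. -/
def qPoch (q x : ℂ) : ℤ → ℂ
  | Int.ofNat n => ∏ j ∈ Finset.range n, (1 - x * q ^ j)
  | Int.negSucc n => (∏ j ∈ Finset.range (n + 1), (1 - x * (q ^ (j + 1))⁻¹))⁻¹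

/-- `(x₁, …, x_m; q)_n = (x₁; q)_n ⋯ (x_m; q)_n`. -/
def qPochList (q : ℂ) (xs : List ℂ) (n : ℤ) : ℂ := (xs.map fun x => qPoch q x n).prod

/-- The Jacobi theta function
`θ(x) = (1 / (q; q)_∞) ∑_{n ∈ ℤ} (-1)^n q^{n (n - 1) / 2} x^n`. -/
def qTheta (q x : ℂ) : ℂ :=
  (∑' n : ℤ, (-1 : ℂ) ^ n * q ^ (n * (n - 1) / 2) * x ^ n) / qInf q q

/-- `θ(x₁, …, x_m) = θ(x₁) ⋯ θ(x_m)`. -/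
def qThetaList (q : ℂ) (xs : List ℂ) : ℂ := (xs.map (qTheta q)).prod

/-- `Ω(x₁, …, x_n; a₁, …, a_m) = ∏_i ∏_j (x_i / a_j; q)_∞`. -/
def qOmega (q : ℂ) (xs as : List ℂ) : ℂ :=
  (xs.map fun x => (as.map fun y => qInf q (x / y)).prod).prod

/-- The `n`-th term of the bilateral series `ᵣψᵣ[as; bs; q, z]`. If some entry of `bs` is `q^m`
with `m ≥ 1`, then for `n ≤ -m` the factor `1 / (q^m; q)_n` is `0`, as it should be: here
`(q^m; q)_n` is the inverse of zero, and both inversions are of zero. -/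
def psiTerm (q : ℂ) (as bs : List ℂ) (z : ℂ) (n : ℤ) : ℂ :=
  qPochList q as n / qPochList q bs n * z ^ n

/-- Every term of `ᵣψᵣ[as; bs; q, z]` is well defined, that is, contains no zero factor in a
denominator: neither a factor `1 - a_i q^{-j}`, `j ≥ 1`, (from `(a_i; q)_n` with `n < 0`) nor a
factor `1 - b_i q^j`, `j ≥ 0`, (from `(b_i; q)_n` with `n > 0`) vanishes. -/
def PsiDefined (q : ℂ) (as bs : List ℂ) : Prop :=
  (∀ y ∈ as, ∀ j : ℕ, 1 - y * (q ^ (j + 1))⁻¹ ≠ 0) ∧ ∀ y ∈ bs, ∀ j : ℕ, 1 - y * q ^ j ≠ 0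

/-- Upper parameters `q √a, -q √a, a₃, …, a_r` of the very-well-poised series. The choice of the
square root is immaterial. -/
def vwpUpper (q a : ℂ) (l : List ℂ) : List ℂ :=
  q * a ^ (1 / 2 : ℂ) :: -(q * a ^ (1 / 2 : ℂ)) :: l

/-- Lower parameters of the very-well-poised series, determined by `a_i b_i = a q`. -/
def vwpLower (q a : ℂ) (l : List ℂ) : List ℂ := (vwpUpper q a l).map fun y => a * q / y

/-- The `n`-th term of the very-well-poised `ᵣψᵣ[a; a₃, …, a_r; q, z]`, with
`l = [a₃, …, a_r]`. -/
def vwpPsiTerm (q a : ℂ) (l : List ℂ) (z : ℂ) (n : ℤ) : ℂ :=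
  psiTerm q (vwpUpper q a l) (vwpLower q a l) z n

/-- The very-well-poised bilateral series `ᵣψᵣ[a; a₃, …, a_r; q, z]`. -/
def vwpPsi (q a : ℂ) (l : List ℂ) (z : ℂ) : ℂ := ∑' n : ℤ, vwpPsiTerm q a l z n

/-- Every term of `ᵣψᵣ[a; a₃, …, a_r; q, z]` is well defined. -/
def VwpPsiDefined (q a : ℂ) (l : List ℂ) : Prop :=
  PsiDefined q (vwpUpper q a l) (vwpLower q a l)

end

theorem qInf_multipliable {q : ℂ} (hq : ‖q‖ < 1) (x : ℂ) :
    Multipliable fun n : ℕ => 1 - x * q ^ n := by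
  have h : Summable fun n : ℕ => ‖-(x * q ^ n)‖ := by
    simp only [norm_neg, norm_mul, norm_pow]
    exact (summable_geometric_of_lt_one (norm_nonneg q) hq).mul_left _
  simpa [sub_eq_add_neg] using multipliable_one_add_of_summable h

theorem qInf_eq_mul {q : ℂ} (hq : ‖q‖ < 1) (x : ℂ) (n : ℕ) :
    qInf q x = (∏ j ∈ Finset.range n, (1 - x * q ^ j)) * qInf q (x * q ^ n) := by
  induction n with
  | zero => simp
  | succ n ih =>
    have h : qInf q (x * q ^ n) = (1 - x * q ^ n) * qInf q (x * q ^ (n + 1)) := by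
      unfold qInf
      rw [tprod_eq_zero_mul' (f := fun j : ℕ => 1 - x * q ^ n * q ^ j)]
      · simp only [pow_zero, mul_one]
        congr 2
        funext j
        ring
      · have := qInf_multipliable hq (x * q ^ (n + 1))
        refine this.congr fun j => ?_
        ring
    rw [ih, h, Finset.prod_range_succ]
    ring

/-- `(x; q)_n = (x; q)_∞ / (q^n x; q)_∞` whenever the denominator is not zero. -/
theorem qPoch_eq_div {q : ℂ} (hq0 : 0 < ‖q‖) (hq : ‖q‖ < 1) (x : ℂ) (n : ℤ)
    (h : qInf q (q ^ n * x) ≠ 0) : qPoch q x n = qInf q x / qInf q (q ^ n * x) := by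
  have hq' : q ≠ 0 := norm_pos_iff.mp hq0
  rw [eq_div_iff h]
  cases n with
  | ofNat n =>
    rw [qInf_eq_mul hq x n]
    simp [qPoch, mul_comm]
  | negSucc n =>
    have e : qInf q (q ^ (Int.negSucc n) * x) =
        (∏ j ∈ Finset.range (n + 1), (1 - x * (q ^ (j + 1))⁻¹)) * qInf q x := by
      rw [qInf_eq_mul hq _ (n + 1)]
      congr 1
      · rw [← Finset.prod_range_reflect]
        refine Finset.prod_congr rfl fun j hj => ?_
        have hj' : j ≤ n := by simpa [Nat.lt_succ_iff] using hj
        obtain ⟨k, rfl⟩ := Nat.exists_eq_add_of_le hj'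
        have : j + k + 1 - 1 - j = k := by omega
        rw [this, zpow_negSucc]
        congr 1
        field_simp
        ring
      · rw [zpow_negSucc]
        congr 1
        field_simp
    rw [e] at h ⊢
    simp only [qPoch]
    rw [inv_mul_cancel_left₀ (left_ne_zero_of_mul h)]

/-! The three series are values of one function. Fix `s` with `s ^ 2 = a` and let `α i` be the six
parameters divided by `s`. Multiply the term of index `n` of a very-well-poised series with base `ξ
^ 2` and parameters `ξ * α i` by a constant that clears its poles. It then depends on `ξ` and `n`
essentially through the lattice point `ξ q ^ n`, and the argument is `q ^ 2 / ∏ α i`, independent of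
`ξ`. The resulting sum `vwpSum` is holomorphic for `ξ ≠ 0`. The series of the theorem are its values
at `s`, `b x / s` and `x z / s`, up to explicit factors (`summable_vwpPsiTerm_and_vwpSum_eq`).

Reindexing the lattice gives `f (q ξ) = q⁻³ ξ⁻⁶ f ξ` and `f ξ⁻¹ = -f ξ`. On Laurent coefficients
these read `c (m + 6) = q ^ (m + 3) c m` and `c (-m) = -c m`, which leave only `c 1` and `c 2` free
(`IsOddTheta.eq_zero`). The space of such functions thus has dimension at most two, so `f s` is a
combination of `f y₁` and `f y₂` (`IsOddTheta.interpolation`). The interpolating functions are the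
theta products `vwpTheta q y₁` and `vwpTheta q y₂`, each vanishing at its own node; their values
give the coefficients of the theorem. The triple product identity is never needed: the sum form and
the product form of theta each get their functional equations directly. -/

open Finset Filter Topology

/-! ### Infinite products and shifted factorials of integer index. -/

theorem qInf_succ {q : ℂ} (hq : ‖q‖ < 1) (x : ℂ) :
    qInf q x = (1 - x) * qInf q (q * x) := by
  simpa [mul_comm] using qInf_eq_mul hq x 1

/-- The point is uniformity in `n`: it lets the terms of the lattice sum be dominated by a geometric
series. -/
theorem norm_prod_one_sub_mul_pow_le {q : ℂ} (hq : ‖q‖ < 1) (x : ℂ) (n : ℕ) :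
    ‖∏ j ∈ range n, (1 - x * q ^ j)‖ ≤ Real.exp (‖x‖ / (1 - ‖q‖)) := by
  have hs := summable_geometric_of_lt_one (norm_nonneg q) hq
  calc ‖∏ j ∈ range n, (1 - x * q ^ j)‖ = ∏ j ∈ range n, ‖1 - x * q ^ j‖ := norm_prod _ _
    _ ≤ ∏ j ∈ range n, Real.exp (‖x‖ * ‖q‖ ^ j) := by
        refine prod_le_prod (fun _ _ => norm_nonneg _) fun j _ => ?_
        calc ‖1 - x * q ^ j‖ ≤ ‖(1 : ℂ)‖ + ‖x * q ^ j‖ := norm_sub_le _ _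
          _ = ‖x‖ * ‖q‖ ^ j + 1 := by simp [add_comm]
          _ ≤ _ := Real.add_one_le_exp _
    _ = Real.exp (‖x‖ * ∑ j ∈ range n, ‖q‖ ^ j) := by rw [← Real.exp_sum, mul_sum]
    _ ≤ Real.exp (‖x‖ * (1 - ‖q‖)⁻¹) := by
        rw [← tsum_geometric_of_lt_one (norm_nonneg q) hq]
        gcongr
        exact hs.sum_le_tsum _ fun _ _ => by positivity
    _ = _ := by rw [div_eq_mul_inv]

theorem norm_qInf_le {q : ℂ} (hq : ‖q‖ < 1) (x : ℂ) :
    ‖qInf q x‖ ≤ Real.exp (‖x‖ / (1 - ‖q‖)) :=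
  le_of_tendsto ((qInf_multipliable hq x).hasProd.tendsto_prod_nat).norm
    (Eventually.of_forall fun n => norm_prod_one_sub_mul_pow_le hq x n)

theorem qInf_ne_zero {q : ℂ} (hq : ‖q‖ < 1) {x : ℂ} (h : ∀ j : ℕ, 1 - x * q ^ j ≠ 0) :
    qInf q x ≠ 0 := by
  have := tprod_one_add_ne_zero_of_summable (f := fun n : ℕ => -(x * q ^ n))
    (fun i => by simpa [sub_eq_add_neg] using h i) (by
      simp only [norm_neg, norm_mul, norm_pow]
      exact (summable_geometric_of_lt_one (norm_nonneg q) hq).mul_left _)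
  simpa [qInf, sub_eq_add_neg] using this

theorem differentiable_qInf {q : ℂ} (hq : ‖q‖ < 1) : Differentiable ℂ (qInf q) := by
  have key : HasProdLocallyUniformlyOn (fun (n : ℕ) (x : ℂ) => 1 + -(x * q ^ n))
      (fun x => ∏' n : ℕ, (1 + -(x * q ^ n))) Set.univ := by
    apply hasProdLocallyUniformlyOn_of_forall_compact isOpen_univ
    intro K _ hcK
    obtain ⟨C, hC⟩ := hcK.isBounded.exists_norm_le
    refine ((summable_geometric_of_lt_one (norm_nonneg q) hq).mul_left C).hasProdUniformlyOn_nat_one_add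
      hcK (.of_forall fun n x hx ↦ ?_) (fun _ ↦ by fun_prop)
    rw [norm_neg, norm_mul, norm_pow]
    gcongr
    exact hC x hx
  have := key.differentiableOn (.of_forall fun _ ↦ by
    simpa [Finset.prod_fn] using DifferentiableOn.finsetProd (fun _ _ ↦ by fun_prop)) isOpen_univ
  rw [differentiableOn_univ] at this
  simpa [qInf, sub_eq_add_neg] using! this

theorem qPoch_succ {q y : ℂ} (n : ℤ)
    (h : ∀ j : ℕ, (j : ℤ) < -n → 1 - y * (q ^ (j + 1))⁻¹ ≠ 0) :
    qPoch q y (n + 1) = (1 - y * q ^ n) * qPoch q y n := by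
  cases n with
  | ofNat n =>
    change qPoch q y (Int.ofNat (n + 1)) = _
    simp [qPoch, prod_range_succ, mul_comm]
  | negSucc n =>
    have h1 : 1 - y * (q ^ (n + 1))⁻¹ ≠ 0 := h n (by omega)
    rw [zpow_negSucc]
    cases n with
    | zero => simpa [qPoch] using! (mul_inv_cancel₀ h1).symm
    | succ m =>
      change qPoch q y (Int.negSucc m) = _
      simp only [qPoch]
      rw [prod_range_succ _ (m + 1), mul_inv, mul_comm, mul_assoc, inv_mul_cancel₀ h1, mul_one]

/-- For `n < 0` the inverse of `qPoch` is a plain finite product, so this form of the recurrence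
needs no condition there. It stays valid for lower parameters `q ^ m`, `m ≥ 1`. -/
theorem qPoch_inv_eq {q y : ℂ} (n : ℤ) (h : ∀ j : ℕ, (j : ℤ) ≤ n → 1 - y * q ^ j ≠ 0) :
    (qPoch q y n)⁻¹ = (1 - y * q ^ n) * (qPoch q y (n + 1))⁻¹ := by
  cases n with
  | ofNat n =>
    have h1 : 1 - y * q ^ n ≠ 0 := h n (by simp)
    change _ = _ * (qPoch q y (Int.ofNat (n + 1)))⁻¹
    simp only [qPoch, prod_range_succ, mul_inv, Int.ofNat_eq_natCast, zpow_natCast]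
    field_simp
  | negSucc n =>
    rw [zpow_negSucc]
    cases n with
    | zero => simp [qPoch]
    | succ m =>
      change _ = _ * (qPoch q y (Int.negSucc m))⁻¹
      simp only [qPoch, inv_inv]
      rw [prod_range_succ _ (m + 1), mul_comm]

/-- Both sides obey the same first-order recurrence in `n` and agree at `n = 0`. -/
theorem qInf_zpow_mul {q y : ℂ} (hq0 : q ≠ 0) (hq : ‖q‖ < 1) (h : ∀ j : ℕ, 1 - y * q ^ j ≠ 0)
    (n : ℤ) : qInf q (q ^ n * y) = qInf q y * (qPoch q y n)⁻¹ := by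
  have step (n : ℤ) : qInf q (q ^ n * y) = (1 - y * q ^ n) * qInf q (q ^ (n + 1) * y) := by
    rw [qInf_succ hq, zpow_add_one₀ hq0]
    ring_nf
  induction n using Int.induction_on with
  | zero => simp [qPoch]
  | succ n ih =>
    have h1 : 1 - y * q ^ (n : ℤ) ≠ 0 := by simpa using h n
    refine mul_left_cancel₀ h1 ?_
    rw [← step, ih, qPoch_inv_eq _ fun j _ => h j]
    ring
  | pred n ih =>
    rw [step, sub_add_cancel, ih, qPoch_inv_eq (-(n : ℤ) - 1) fun j _ => h j, sub_add_cancel]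
    ring

theorem triangle_succ (n : ℤ) : (n + 1) * (n + 1 - 1) / 2 = n * (n - 1) / 2 + n := by
  rw [show (n + 1) * (n + 1 - 1) = n * (n - 1) + n * 2 by ring, Int.add_mul_ediv_right _ _ (by norm_num)]

/-- Reversal of the shifted factorial. -/
theorem qInf_div_zpow_mul {q y : ℂ} (hq0 : q ≠ 0) (hq : ‖q‖ < 1) (hy : y ≠ 0) (n : ℤ)
    (h : ∀ j : ℕ, (j : ℤ) < -n → 1 - y * (q ^ (j + 1))⁻¹ ≠ 0) :
    qInf q (q / (q ^ n * y)) =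
      (-1) ^ n * (q ^ (n * (n - 1) / 2))⁻¹ * (y ^ n)⁻¹ * (qInf q (q / y) * qPoch q y n) := by
  have step (n : ℤ) : qInf q (q / (q ^ (n + 1) * y)) =
      (-1) * (q ^ n)⁻¹ * y⁻¹ * (1 - y * q ^ n) * qInf q (q / (q ^ n * y)) := by
    have hn : q ^ n ≠ 0 := zpow_ne_zero _ hq0
    rw [qInf_succ hq, zpow_add_one₀ hq0]
    congr 1
    · field_simp
      ring
    · congr 1
      field_simp
  have hm : (-1 : ℂ) ≠ 0 := by norm_num
  induction n using Int.induction_on with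
  | zero => simp [qPoch]
  | succ n ih =>
    rw [step, ih fun j hj => by omega, qPoch_succ _ fun j hj => by omega, triangle_succ,
      zpow_add₀ hq0, zpow_add_one₀ hm, zpow_add_one₀ hy, mul_inv, mul_inv]
    ring
  | pred n ih =>
    have h1 : 1 - y * q ^ (-(n : ℤ) - 1) ≠ 0 := by
      have := h n (by omega)
      rwa [show -(n : ℤ) - 1 = -((n + 1 : ℕ) : ℤ) by push_cast; ring, zpow_neg, zpow_natCast]
    set m : ℤ := -(n : ℤ) - 1 with hmdef
    have e : -(n : ℤ) = m + 1 := by omega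
    have := ih fun j hj => h j (by omega)
    have ht := triangle_succ m
    rw [add_sub_cancel_right] at ht
    rw [e, step, qPoch_succ _ h, ht, zpow_add₀ hq0, zpow_add_one₀ hm,
      zpow_add_one₀ hy, mul_inv, mul_inv] at this
    have hn : q ^ m ≠ 0 := zpow_ne_zero _ hq0
    refine mul_left_cancel₀ (a := (-1) * (q ^ m)⁻¹ * y⁻¹ * (1 - y * q ^ m)) ?_ ?_
    · simp [hn, hy, h1]
    · rw [this]; ring

/-! ### The theta series: functional equations and holomorphy. -/

theorem qTheta_q_mul {q x : ℂ} (hq : q ≠ 0) (hx : x ≠ 0) :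
    qTheta q (q * x) = -x⁻¹ * qTheta q x := by
  unfold qTheta
  rw [← mul_div_assoc, ← tsum_mul_left, ← (Equiv.addRight (1 : ℤ)).tsum_eq]
  congr 1
  conv_rhs => rw [← (Equiv.addRight (1 : ℤ)).tsum_eq, ← (Equiv.addRight (1 : ℤ)).tsum_eq]
  refine tsum_congr fun n => ?_
  simp only [Equiv.coe_addRight]
  rw [triangle_succ (n + 1), zpow_add₀ hq (_ / 2), zpow_add_one₀ (by norm_num : (-1 : ℂ) ≠ 0) (n + 1),
    zpow_add_one₀ hx (n + 1), mul_zpow]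
  field_simp

theorem qTheta_inv {q x : ℂ} (hx : x ≠ 0) : qTheta q x⁻¹ = -x⁻¹ * qTheta q x := by
  unfold qTheta
  rw [← mul_div_assoc, ← tsum_mul_left]
  congr 1
  -- The reflection `n ↦ 1 - n` fixes `n (n - 1) / 2` and changes the sign `(-1) ^ n`.
  conv_rhs => rw [← (Equiv.subLeft (1 : ℤ)).tsum_eq]
  refine tsum_congr fun n => ?_
  simp only [Equiv.subLeft_apply]
  rw [show (1 - n) * (1 - n - 1) = n * (n - 1) by ring, sub_eq_add_neg 1 n,
    zpow_add₀ (by norm_num : (-1 : ℂ) ≠ 0), zpow_add₀ hx, zpow_neg, zpow_neg]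
  have h1 : ((-1 : ℂ) ^ n)⁻¹ = (-1) ^ n := by rw [← inv_zpow]; norm_num
  rw [h1, zpow_one, zpow_one, inv_zpow]
  field_simp

/-- Majorant of the theta series on the annulus `M⁻¹ < ‖x‖ < M`. The ratio of consecutive terms is
`r ^ n * M → 0`, and the term at `-n` is at most the term at `n`. -/
theorem summable_pow_triangle_mul_pow {r : ℝ} (hr0 : 0 < r) (hr : r < 1) {M : ℝ} (hM : 0 < M) :
    Summable fun n : ℤ => r ^ (n * (n - 1) / 2) * M ^ n.natAbs := by
  have base : Summable fun n : ℕ => r ^ ((n : ℤ) * (n - 1) / 2) * M ^ n := by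
    have pos (n : ℕ) : 0 < r ^ ((n : ℤ) * (n - 1) / 2) * M ^ n := by positivity
    refine summable_of_ratio_test_tendsto_lt_one (l := 0) one_pos
      (.of_forall fun n => (pos n).ne') ?_
    have : Tendsto (fun n : ℕ => r ^ n * M) atTop (𝓝 (0 * M)) :=
      (tendsto_pow_atTop_nhds_zero_of_lt_one hr0.le hr).mul_const M
    rw [zero_mul] at this
    refine this.congr fun n => ?_
    rw [Real.norm_of_nonneg (pos _).le, Real.norm_of_nonneg (pos _).le, eq_div_iff (pos n).ne']
    push_cast
    rw [triangle_succ, zpow_add₀ hr0.ne', zpow_natCast]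
    ring
  refine Summable.of_nat_of_neg (by simpa using base) ?_
  refine Summable.of_nonneg_of_le (fun n => by positivity) (fun n => ?_) base
  simp only [Int.natAbs_neg, Int.natAbs_natCast]
  gcongr ?_ * _
  refine zpow_le_zpow_right_of_le_one₀ hr0 hr.le ?_
  apply Int.ediv_le_ediv (by norm_num)
  nlinarith

theorem differentiableOn_qTheta {q : ℂ} (hq0 : q ≠ 0) (hq : ‖q‖ < 1) :
    DifferentiableOn ℂ (qTheta q) {0}ᶜ := by
  unfold qTheta
  refine DifferentiableOn.div_const ?_ _
  intro x hx
  have hx : x ≠ 0 := hx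
  obtain ⟨M, hM⟩ : ∃ M, max ‖x‖ ‖x⁻¹‖ < M := exists_gt _
  rw [max_lt_iff] at hM
  have hM0 : 0 < M := (norm_nonneg _).trans_lt hM.1
  let U : Set ℂ := {y | y ≠ 0 ∧ ‖y‖ < M ∧ M⁻¹ < ‖y‖}
  have hU : IsOpen U := by
    refine isOpen_ne.inter (IsOpen.inter ?_ ?_)
    · exact isOpen_lt continuous_norm continuous_const
    · exact isOpen_lt continuous_const continuous_norm
  have hxU : x ∈ U := ⟨hx, hM.1, by
    rw [norm_inv] at hM
    exact inv_lt_of_inv_lt₀ (norm_pos_iff.mpr hx) hM.2⟩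
  refine ((Complex.differentiableOn_tsum_of_summable_norm (U := U)
    (summable_pow_triangle_mul_pow (norm_pos_iff.mpr hq0) hq hM0) ?_ hU ?_).differentiableAt
    (hU.mem_nhds hxU)).differentiableWithinAt
  · intro n y hy
    exact ((differentiableAt_zpow.mpr (Or.inl hy.1)).const_mul _).differentiableWithinAt
  · rintro n y ⟨hy0, hy1, hy2⟩
    rw [norm_mul, norm_mul, norm_zpow, norm_zpow, norm_zpow, norm_neg, norm_one, one_zpow, one_mul]
    gcongr ?_ * ?_
    obtain hn | hn := Int.natAbs_eq n
    · rw [hn, zpow_natCast, Int.natAbs_natCast]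
      gcongr
    · rw [hn, zpow_neg, zpow_natCast, Int.natAbs_neg, Int.natAbs_natCast, ← inv_pow]
      gcongr
      exact inv_le_of_inv_le₀ hM0 hy2.le

/-! ### Laurent coefficients on the punctured plane. -/

open Real in
/-- Averages over circles around the puncture of a function holomorphic on `ℂ \ {0}` do not depend
on the circle. -/
theorem circleAverage_comp_mul_left {f : ℂ → ℂ} (hf : DifferentiableOn ℂ f {0}ᶜ) {v : ℂ}
    (hv : v ≠ 0) : circleAverage (fun ξ => f (v * ξ)) 0 1 = circleAverage f 0 1 := by
  have hd : ∀ z : ℂ, z ≠ 0 → DifferentiableAt ℂ f z := fun z hz =>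
    hf.differentiableAt (isOpen_compl_singleton.mem_nhds hz)
  -- Cauchy's theorem for `f z / z` on the annulus between the circles.
  have mono : ∀ r R : ℝ, 0 < r → r ≤ R → circleAverage f 0 R = circleAverage f 0 r := by
    intro r R hr hrR
    rw [circleAverage_eq_circleIntegral hr.ne', circleAverage_eq_circleIntegral (hr.trans_le hrR).ne']
    congr 1
    refine Complex.circleIntegral_sub_center_inv_smul_eq_of_differentiable_on_annulus_off_countable
      hr hrR Set.countable_empty ?_ ?_
    · refine hf.continuousOn.mono ?_
      rintro z ⟨-, hz⟩ rfl
      exact hz (by simpa using hr)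
    · rintro z ⟨⟨-, hz⟩, -⟩
      refine hd z ?_
      rintro rfl
      exact hz (by simpa using hr.le)
  have hv0 : 0 < ‖v‖ := norm_pos_iff.mpr hv
  have e : circleAverage f 0 ‖v‖ = circleAverage f 0 1 := by
    rcases le_total ‖v‖ 1 with h | h
    · exact (mono _ _ hv0 h).symm
    · exact mono _ _ one_pos h
  -- Multiplication by `v` is a dilation by `‖v‖`, already handled, and a rotation by `v.arg`, a
  -- mere shift of the angle.
  rw [← e, circleAverage_def, circleAverage_eq_integral_add v.arg]
  congr 2
  funext θ
  congr 1
  have e2 := Complex.norm_mul_exp_arg_mul_I v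
  simp only [circleMap_zero]
  push_cast
  rw [add_mul, Complex.exp_add]
  linear_combination (-Complex.exp (θ * Complex.I)) * e2

open Real in
/-- A continuous function on the unit circle all of whose Fourier coefficients vanish is zero. -/
theorem eq_zero_of_circleAverage_eq_zero {f : ℂ → ℂ} (hf : ContinuousOn f {0}ᶜ)
    (h : ∀ m : ℤ, circleAverage (fun ξ => ξ ^ (-m) * f ξ) 0 1 = 0) : f 1 = 0 := by
  have : Fact (0 < 2 * π) := ⟨by positivity⟩
  let F : C(AddCircle (2 * π), ℂ) :=
    ⟨fun x => f (AddCircle.toCircle x), by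
      refine hf.comp_continuous
        (continuous_subtype_val.comp AddCircle.continuous_toCircle) fun x => ?_
      exact Circle.coe_ne_zero _⟩
  have hF : fourierCoeff F = 0 := by
    funext m
    rw [fourierCoeff_eq_intervalIntegral _ _ 0, zero_add, one_div]
    refine Eq.trans ?_ (h m)
    rw [circleAverage_def]
    congr 2
    funext θ
    have e : ((AddCircle.toCircle (θ : AddCircle (2 * π)) : Circle) : ℂ) = circleMap 0 1 θ := by
      rw [AddCircle.toCircle_apply_mk, circleMap_zero, Circle.coe_exp]
      have : 2 * π ≠ 0 := by positivity
      rw [div_self this]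
      simp
    rw [fourier_apply, AddCircle.toCircle_zsmul, Circle.coe_zpow, e, smul_eq_mul]
    change _ * f _ = _
    rw [e]
  -- Zero coefficients are summable, so the Fourier series converges pointwise to `F`; the angle `0`
  -- is the point `1`.
  have hs := has_pointwise_sum_fourier_series_of_summable (f := F)
    (by rw [hF]; exact summable_zero) 0
  rw [hF] at hs
  simp only [Pi.zero_apply, zero_smul] at hs
  have := hs.unique hasSum_zero
  simpa [F] using this

/-- The coefficient of `ξ ^ m` in the Laurent expansion of `f` on the punctured plane. -/
noncomputable def laurentCoeff (f : ℂ → ℂ) (m : ℤ) : ℂ := Real.circleAverage (fun ξ => ξ ^ (-m) * f ξ) 0 1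

theorem differentiableOn_zpow_mul {f : ℂ → ℂ} (hf : DifferentiableOn ℂ f {0}ᶜ) (m : ℤ) :
    DifferentiableOn ℂ (fun ξ => ξ ^ m * f ξ) {0}ᶜ :=
  fun x hx => (differentiableAt_zpow.mpr (Or.inl hx)).differentiableWithinAt.mul (hf x hx)

theorem laurentCoeff_comp_mul_left {f : ℂ → ℂ} (hf : DifferentiableOn ℂ f {0}ᶜ) {v : ℂ}
    (hv : v ≠ 0) (m : ℤ) : laurentCoeff (fun ξ => f (v * ξ)) m = v ^ m * laurentCoeff f m := by
  rw [laurentCoeff, laurentCoeff, ← circleAverage_comp_mul_left (differentiableOn_zpow_mul hf (-m)) hv,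
    ← smul_eq_mul, ← Real.circleAverage_fun_smul]
  congr 1
  funext ξ
  rw [mul_zpow, smul_eq_mul, zpow_neg v]
  field_simp

/-- `f v` is the value at `1` of `ξ ↦ f (v * ξ)`, whose coefficients are those of `f` times `v ^ m`.
Hence the Fourier argument on the unit circle reaches every point. -/
theorem eq_zero_of_laurentCoeff_eq_zero {f : ℂ → ℂ} (hf : DifferentiableOn ℂ f {0}ᶜ)
    (h : ∀ m, laurentCoeff f m = 0) {v : ℂ} (hv : v ≠ 0) : f v = 0 := by
  have hg : ContinuousOn (fun ξ => f (v * ξ)) {0}ᶜ :=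
    hf.continuousOn.comp (by fun_prop) fun ξ hξ => mul_ne_zero hv hξ
  simpa using eq_zero_of_circleAverage_eq_zero hg fun m =>
    (laurentCoeff_comp_mul_left hf hv m).trans (by rw [h, mul_zero])

/-! ### Odd theta functions of degree six and their interpolation. -/

/-- Odd theta functions of degree six: holomorphic functions on the punctured plane with
`f (q ξ) = q⁻³ ξ⁻⁶ f ξ` and `f (1 / ξ) = - f ξ`. -/
structure IsOddTheta (q : ℂ) (f : ℂ → ℂ) : Prop where
  differentiableOn : DifferentiableOn ℂ f {0}ᶜ
  map_q_mul : ∀ ξ ≠ 0, f (q * ξ) = (q ^ 3)⁻¹ * (ξ ^ 6)⁻¹ * f ξ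
  map_inv : ∀ ξ ≠ 0, f ξ⁻¹ = -f ξ

namespace IsOddTheta

variable {q : ℂ} {f g : ℂ → ℂ}

theorem add (hf : IsOddTheta q f) (hg : IsOddTheta q g) : IsOddTheta q (fun ξ => f ξ + g ξ) where
  differentiableOn := hf.differentiableOn.add hg.differentiableOn
  map_q_mul ξ hξ := by rw [hf.map_q_mul ξ hξ, hg.map_q_mul ξ hξ, mul_add]
  map_inv ξ hξ := by rw [hf.map_inv ξ hξ, hg.map_inv ξ hξ, neg_add]

theorem const_mul (hf : IsOddTheta q f) (c : ℂ) : IsOddTheta q (fun ξ => c * f ξ) where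
  differentiableOn := hf.differentiableOn.const_mul c
  map_q_mul ξ hξ := by rw [hf.map_q_mul ξ hξ]; ring
  map_inv ξ hξ := by rw [hf.map_inv ξ hξ]; ring

theorem laurentCoeff_add_six (hf : IsOddTheta q f) (hq : q ≠ 0) (m : ℤ) :
    laurentCoeff f (m + 6) = q ^ (m + 3) * laurentCoeff f m := by
  have h1 := laurentCoeff_comp_mul_left hf.differentiableOn hq m
  have h2 : laurentCoeff (fun ξ => f (q * ξ)) m = (q ^ 3)⁻¹ * laurentCoeff f (m + 6) := by
    rw [laurentCoeff, laurentCoeff, ← smul_eq_mul, ← Real.circleAverage_fun_smul]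
    refine Real.circleAverage_congr_sphere fun ξ hξ => ?_
    have hξ0 : ξ ≠ 0 := by
      rintro rfl
      simp at hξ
    simp only [smul_eq_mul]
    rw [hf.map_q_mul ξ hξ0, neg_add, zpow_add₀ hξ0]
    rw [show (-6 : ℤ) = -((6 : ℕ) : ℤ) by norm_num, zpow_neg ξ (6 : ℕ), zpow_natCast]
    ring
  rw [h2] at h1
  rw [zpow_add₀ hq, mul_assoc, mul_left_comm, ← h1]
  norm_cast
  field_simp

theorem laurentCoeff_neg (hf : IsOddTheta q f) (m : ℤ) :
    laurentCoeff f (-m) = -laurentCoeff f m := by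
  rw [laurentCoeff, laurentCoeff, ← Real.circleAverage_zero_one_congr_inv, ← neg_one_smul ℂ (Real.circleAverage _ 0 1),
    ← Real.circleAverage_fun_smul]
  refine Real.circleAverage_congr_sphere fun ξ hξ => ?_
  have hξ0 : ξ ≠ 0 := by
    rintro rfl
    simp at hξ
  simp [hf.map_inv ξ hξ0]

/-- Vanishing of a coefficient depends only on the index modulo 6, up to sign. Classes 4 and 5 are
the negatives of 2 and 1. Classes 0 and 3 are their own negatives, and oddness kills them because
the multiplier `q ^ (m + 3)` is `1` at `m = -3`. -/
theorem eq_zero (hf : IsOddTheta q f) (hq : q ≠ 0) (h1 : laurentCoeff f 1 = 0)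
    (h2 : laurentCoeff f 2 = 0) {v : ℂ} (hv : v ≠ 0) : f v = 0 := by
  have period (m : ℤ) : laurentCoeff f (m + 6) = 0 ↔ laurentCoeff f m = 0 := by
    simp [hf.laurentCoeff_add_six hq, zpow_ne_zero _ hq]
  have per (m k : ℤ) : laurentCoeff f (m + 6 * k) = 0 ↔ laurentCoeff f m = 0 := by
    induction k using Int.induction_on with
    | zero => simp
    | succ k ih => rw [← ih, ← period (m + 6 * k)]; ring_nf
    | pred k ih => rw [← ih, ← period (m + 6 * (-(k : ℤ) - 1))]; ring_nf
  refine eq_zero_of_laurentCoeff_eq_zero hf.differentiableOn (fun m => ?_) hv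
  have c0 : laurentCoeff f 0 = 0 := by
    have := hf.laurentCoeff_neg 0
    rwa [neg_zero, self_eq_neg] at this
  have c3 : laurentCoeff f 3 = 0 := by
    have e1 := hf.laurentCoeff_neg 3
    have e2 := hf.laurentCoeff_add_six hq (-3)
    norm_num at e2
    rw [e1, self_eq_neg] at e2
    exact e2
  have c4 : laurentCoeff f 4 = 0 := by
    rw [← period, ← neg_eq_zero, ← hf.laurentCoeff_neg, ← per _ 2]
    exact h2
  have c5 : laurentCoeff f 5 = 0 := by
    rw [← per _ (-1), ← neg_eq_zero, ← hf.laurentCoeff_neg]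
    exact h1
  rw [← Int.emod_add_mul_ediv m 6, per]
  have hlt : m % 6 < 6 := Int.emod_lt_of_pos m (by norm_num)
  have hnn : 0 ≤ m % 6 := Int.emod_nonneg m (by norm_num)
  generalize m % 6 = i at hlt hnn ⊢
  interval_cases i <;> assumption

theorem laurentCoeff_add (hf : IsOddTheta q f) (hg : IsOddTheta q g) (m : ℤ) :
    laurentCoeff (fun ξ => f ξ + g ξ) m = laurentCoeff f m + laurentCoeff g m := by
  have int {f : ℂ → ℂ} (hf : DifferentiableOn ℂ f {0}ᶜ) :
      CircleIntegrable (fun ξ => ξ ^ (-m) * f ξ) 0 1 :=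
    ContinuousOn.circleIntegrable zero_le_one
      ((differentiableOn_zpow_mul hf (-m)).continuousOn.mono fun ξ hξ => by
        rintro rfl
        simp at hξ)
  rw [laurentCoeff, laurentCoeff, laurentCoeff,
    ← Real.circleAverage_fun_add (int hf.differentiableOn) (int hg.differentiableOn)]
  simp only [mul_add]

theorem laurentCoeff_const_mul (c : ℂ) (m : ℤ) :
    laurentCoeff (fun ξ => c * f ξ) m = c * laurentCoeff f m := by
  rw [laurentCoeff, laurentCoeff, ← smul_eq_mul, ← Real.circleAverage_fun_smul]
  simp only [smul_eq_mul, mul_left_comm]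

/-- Interpolation: an odd theta function of degree six is determined by its values at two points in
general position. -/
theorem interpolation (hq : q ≠ 0) {F₁ F₂ : ℂ → ℂ} (hf : IsOddTheta q f) (h₁ : IsOddTheta q F₁)
    (h₂ : IsOddTheta q F₂) {s y₁ y₂ : ℂ} (hs : s ≠ 0) (hy₁ : y₁ ≠ 0) (hy₂ : y₂ ≠ 0)
    (h11 : F₁ y₁ = 0) (h22 : F₂ y₂ = 0) (h12 : F₁ y₂ ≠ 0) (h21 : F₂ y₁ ≠ 0) :
    f s = f y₁ * F₂ s / F₂ y₁ + f y₂ * F₁ s / F₁ y₂ := by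
  let p (i : Fin 3) : ℂ := laurentCoeff (![f, F₁, F₂] i) 1
  let r (i : Fin 3) : ℂ := laurentCoeff (![f, F₁, F₂] i) 2
  -- Three vectors in the plane are dependent; repeating the row `r` turns this into the singularity
  -- of a square matrix.
  obtain ⟨u, hu, hM⟩ := (Matrix.exists_mulVec_eq_zero_iff (M := Matrix.of ![p, r, r])).mpr
    (Matrix.det_zero_of_row_eq (i := 1) (j := 2) (by decide) rfl)
  obtain ⟨a, b, c, hne, e1, e2⟩ : ∃ a b c : ℂ, ¬(a = 0 ∧ b = 0 ∧ c = 0) ∧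
      a * p 0 + (b * p 1 + c * p 2) = 0 ∧ a * r 0 + (b * r 1 + c * r 2) = 0 := by
    refine ⟨u 0, u 1, u 2, fun h => hu ?_, ?_, ?_⟩
    · funext i
      fin_cases i
      exacts [h.1, h.2.1, h.2.2]
    · have := congrFun hM 0
      simp [Matrix.mulVec, dotProduct, Fin.sum_univ_three] at this
      linear_combination this
    · have := congrFun hM 1
      simp [Matrix.mulVec, dotProduct, Fin.sum_univ_three] at this
      linear_combination this
  have comb : ∀ v ≠ 0, a * f v + (b * F₁ v + c * F₂ v) = 0 := by
    intro v hv
    have hz := (h₁.const_mul b).add (h₂.const_mul c)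
    refine ((hf.const_mul a).add hz).eq_zero hq ?_ ?_ hv
    · rw [laurentCoeff_add (hf.const_mul a) hz, laurentCoeff_add (h₁.const_mul b) (h₂.const_mul c),
        laurentCoeff_const_mul, laurentCoeff_const_mul, laurentCoeff_const_mul]
      exact e1
    · rw [laurentCoeff_add (hf.const_mul a) hz, laurentCoeff_add (h₁.const_mul b) (h₂.const_mul c),
        laurentCoeff_const_mul, laurentCoeff_const_mul, laurentCoeff_const_mul]
      exact e2
  have k1 := comb y₁ hy₁
  have k2 := comb y₂ hy₂
  have k3 := comb s hs
  rw [h11] at k1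
  rw [h22] at k2
  -- If `a = 0`, evaluation at `y₁` and `y₂` forces `c = 0` and `b = 0`.
  have ha : a ≠ 0 := by
    rintro rfl
    simp_all
  have hb : b = -(a * f y₂) / F₁ y₂ := by
    rw [eq_div_iff h12]; linear_combination k2
  have hc : c = -(a * f y₁) / F₂ y₁ := by
    rw [eq_div_iff h21]; linear_combination k1
  rw [hb, hc] at k3
  refine mul_left_cancel₀ ha ?_
  linear_combination k3

end IsOddTheta

/-! ### The very-well-poised lattice sum. -/

/-- The `n`-th term, at the base point `ξ`, of the lattice sum `vwpSum`. -/
noncomputable def vwpLattice (q : ℂ) (α : Fin 6 → ℂ) (ξ : ℂ) (n : ℤ) : ℂ :=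
  ((ξ * q ^ n)⁻¹ - ξ * q ^ n) *
    (∏ i, (qInf q (ξ * q ^ n * q / α i) * qInf q (q / (ξ * q ^ n * α i)))) *
    (q ^ (3 * n ^ 2) * ξ ^ (6 * n))

/-- The very-well-poised sum over the lattice `ξ q ^ ℤ`, normalized to be holomorphic in `ξ`. -/
noncomputable def vwpSum (q : ℂ) (α : Fin 6 → ℂ) (ξ : ℂ) : ℂ := ∑' n : ℤ, vwpLattice q α ξ n

/-- The lattice point of index `n` over `ξ⁻¹` is the inverse of that of index `-n` over `ξ`.
Inverting it swaps the two infinite products and negates the front factor. -/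
theorem vwpLattice_inv (q : ℂ) (α : Fin 6 → ℂ) (ξ : ℂ) (n : ℤ) :
    vwpLattice q α ξ⁻¹ n = -vwpLattice q α ξ (-n) := by
  unfold vwpLattice
  have h1 : ξ⁻¹ * q ^ n = (ξ * q ^ (-n))⁻¹ := by rw [mul_inv, zpow_neg, inv_inv]
  rw [h1, inv_inv]
  generalize ξ * q ^ (-n) = u
  have h2 : ∏ i, (qInf q (u⁻¹ * q / α i) * qInf q (q / (u⁻¹ * α i))) =
      ∏ i, (qInf q (u * q / α i) * qInf q (q / (u * α i))) := by
    refine prod_congr rfl fun i _ => ?_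
    rw [mul_comm]
    congr 2
    · rw [div_eq_mul_inv, mul_inv, inv_inv]; ring
    · rw [div_eq_mul_inv, div_eq_mul_inv, mul_inv]; ring
  rw [h2, show 6 * -n = -(6 * n) by ring, zpow_neg ξ, inv_zpow, neg_sq]
  ring

theorem vwpSum_inv (q : ℂ) (α : Fin 6 → ℂ) (ξ : ℂ) : vwpSum q α ξ⁻¹ = -vwpSum q α ξ := by
  rw [vwpSum, vwpSum, ← tsum_neg, ← (Equiv.neg ℤ).tsum_eq]
  exact tsum_congr fun n => by simp [vwpLattice_inv]

/-- `q * ξ` spans the same lattice, so only the normalization `q ^ (3 n²) ξ ^ (6 n)` matters; the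
multiplier comes from `3 (n + 1)² = 3 n² + 6 n + 3`. -/
theorem vwpSum_q_mul {q : ℂ} (hq : q ≠ 0) (α : Fin 6 → ℂ) {ξ : ℂ} (hξ : ξ ≠ 0) :
    vwpSum q α (q * ξ) = (q ^ 3)⁻¹ * (ξ ^ 6)⁻¹ * vwpSum q α ξ := by
  rw [vwpSum, vwpSum, ← tsum_mul_left]
  conv_rhs => rw [← (Equiv.addRight (1 : ℤ)).tsum_eq]
  refine tsum_congr fun n => ?_
  simp only [Equiv.coe_addRight, vwpLattice]
  have h1 : q * ξ * q ^ n = ξ * q ^ (n + 1) := by rw [zpow_add_one₀ hq]; ring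
  have h2 : q ^ (3 * (n + 1) ^ 2) = q ^ (3 * n ^ 2) * q ^ (6 * n) * q ^ 3 := by
    rw [← zpow_natCast, ← zpow_add₀ hq, ← zpow_add₀ hq]
    congr 1
    push_cast
    ring
  have h3 : ξ ^ (6 * (n + 1)) = ξ ^ (6 * n) * ξ ^ 6 := by
    rw [← zpow_natCast, ← zpow_add₀ hξ]
    congr 1
    push_cast
    ring
  rw [h1, h2, h3, mul_zpow]
  field_simp

/-- The factors of a lattice term, in terms of shifted factorials. -/
theorem vwpLattice_eq {q : ℂ} (hq0 : q ≠ 0) (hq : ‖q‖ < 1) {α : Fin 6 → ℂ} (hα : ∀ i, α i ≠ 0)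
    {ξ : ℂ} (hξ : ξ ≠ 0) (n : ℤ)
    (h : ∀ i, ∀ j : ℕ, (j : ℤ) < -n → 1 - ξ * α i * (q ^ (j + 1))⁻¹ ≠ 0) :
    vwpLattice q α ξ n = (q ^ 2 / ∏ i, α i) ^ n * (ξ⁻¹ * (1 - ξ ^ 2 * q ^ (2 * n))) *
      ∏ i, (qInf q (q ^ n * (ξ * q / α i)) * (qInf q (q / (ξ * α i)) * qPoch q (ξ * α i) n)) := by
  have hn : q ^ n ≠ 0 := zpow_ne_zero _ hq0
  have e1 : ∀ i, qInf q (ξ * q ^ n * q / α i) * qInf q (q / (ξ * q ^ n * α i)) =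
      ((-1) ^ n * (q ^ (n * (n - 1) / 2))⁻¹ * (ξ ^ n)⁻¹) * ((α i) ^ n)⁻¹ *
      (qInf q (q ^ n * (ξ * q / α i)) * (qInf q (q / (ξ * α i)) * qPoch q (ξ * α i) n)) := by
    intro i
    rw [show ξ * q ^ n * α i = q ^ n * (ξ * α i) by ring,
      show ξ * q ^ n * q / α i = q ^ n * (ξ * q / α i) by ring,
      qInf_div_zpow_mul hq0 hq (mul_ne_zero hξ (hα i)) n (h i), mul_zpow, mul_inv]
    ring
  -- The six reversals contribute a trivial sign, `q ^ (-3 n² + 3 n)` and `ξ ^ (-6 n)`. The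
  -- normalization cancels all but `q ^ (3 n)`, and the front factor lowers that to `q ^ (2 n)`.
  have e2 : ((-1 : ℂ) ^ n) ^ 6 = 1 := by
    rw [← zpow_natCast, zpow_comm]
    norm_num
  have e3 : q ^ (3 * n ^ 2) = (q ^ (n * (n - 1) / 2)) ^ 6 * (q ^ n) ^ 3 := by
    rw [← zpow_natCast, ← zpow_natCast, ← zpow_mul, ← zpow_mul, ← zpow_add₀ hq0]
    congr 1
    have := Int.ediv_mul_cancel (Int.even_mul_pred_self n).two_dvd
    push_cast
    linear_combination (-3) * this
  have e4 : ξ ^ (6 * n) = (ξ ^ n) ^ 6 := by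
    rw [← zpow_natCast, ← zpow_mul, mul_comm]
    rfl
  have e5 : q ^ (2 * n) = (q ^ n) ^ 2 := by
    rw [← zpow_natCast, ← zpow_mul, mul_comm]
    rfl
  have e6 : (q ^ 2) ^ n = (q ^ n) ^ 2 := by
    rw [← zpow_natCast, ← zpow_natCast, zpow_comm]
  unfold vwpLattice
  simp only [e1, prod_mul_distrib (f := fun i => _ * ((α i) ^ n)⁻¹), prod_mul_distrib (f := fun _ => _)
    (g := fun i => ((α i) ^ n)⁻¹), prod_const, card_univ, Fintype.card_fin, prod_inv_distrib,
    prod_zpow, mul_pow, e2]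
  rw [e3, e4, e5, div_zpow, e6]
  have hT : q ^ (n * (n - 1) / 2) ≠ 0 := zpow_ne_zero _ hq0
  have hX : ξ ^ n ≠ 0 := zpow_ne_zero _ hξ
  have hA : (∏ i, α i) ^ n ≠ 0 := zpow_ne_zero _ (prod_ne_zero_iff.mpr fun i _ => hα i)
  field_simp

theorem norm_vwpLattice_le {q : ℂ} (hq0 : q ≠ 0) (hq : ‖q‖ < 1) {α : Fin 6 → ℂ}
    (hα : ∀ i, α i ≠ 0) (M : ℝ) : ∃ C, ∀ (n : ℕ) (ξ : ℂ), ξ ≠ 0 → ‖ξ‖ ≤ M → ‖ξ⁻¹‖ ≤ M →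
      ‖vwpLattice q α ξ n‖ ≤ C * ‖q ^ 2 / ∏ i, α i‖ ^ n := by
  let c := 1 - ‖q‖
  have hc : 0 < c := sub_pos.mpr hq
  refine ⟨M * (1 + M ^ 2) * ∏ i, (Real.exp (M * ‖α i‖⁻¹ / c) *
    (Real.exp (M * ‖α i‖⁻¹ / c) * Real.exp (M * ‖α i‖ / c))), fun n ξ hξ h1 h2 => ?_⟩
  have hM : 0 ≤ M := (norm_nonneg _).trans h1
  rw [vwpLattice_eq hq0 hq hα hξ n fun i j hj => by omega, zpow_natCast, norm_mul, norm_mul,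
    norm_pow, norm_prod, mul_assoc, mul_comm]
  have hqn : ∀ n : ℕ, ‖q‖ ^ n ≤ 1 := fun n => pow_le_one₀ (norm_nonneg _) hq.le
  gcongr with i
  · rw [norm_mul]
    gcongr
    refine (norm_sub_le _ _).trans ?_
    rw [norm_one, norm_mul, norm_pow, show (2 * (n : ℤ)) = ((2 * n : ℕ) : ℤ) by simp, zpow_natCast,
      norm_pow]
    gcongr
    calc ‖ξ‖ ^ 2 * ‖q‖ ^ (2 * n) ≤ M ^ 2 * 1 := by
          gcongr
          exact hqn _
      _ = _ := mul_one _
  · rw [norm_mul, norm_mul]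
    gcongr
    · refine (norm_qInf_le hq _).trans ?_
      gcongr
      rw [zpow_natCast, norm_mul, norm_div, norm_mul, norm_pow]
      calc ‖q‖ ^ n * (‖ξ‖ * ‖q‖ / ‖α i‖) ≤ 1 * (M * 1 / ‖α i‖) := by
            gcongr
            exact hqn n
        _ = _ := by ring
    · refine (norm_qInf_le hq _).trans ?_
      gcongr
      rw [norm_div, norm_mul]
      calc ‖q‖ / (‖ξ‖ * ‖α i‖) = ‖q‖ * ‖ξ⁻¹‖ * ‖α i‖⁻¹ := by
            rw [norm_inv]
            field_simp
        _ ≤ 1 * M * ‖α i‖⁻¹ := by gcongr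
        _ = _ := by ring
    · refine (norm_prod_one_sub_mul_pow_le hq _ n).trans ?_
      rw [norm_mul]
      gcongr

theorem summable_natAbs_pow {r : ℝ} (h0 : 0 ≤ r) (h1 : r < 1) (C : ℝ) :
    Summable fun n : ℤ => C * r ^ n.natAbs := by
  refine Summable.mul_left C (Summable.of_nat_of_neg ?_ ?_) <;>
  simpa using summable_geometric_of_lt_one h0 h1

/-- Negative indices reduce to positive ones by inversion of `ξ`, so the single condition on the
argument gives convergence in both directions. -/
theorem exists_norm_vwpLattice_le {q : ℂ} (hq0 : q ≠ 0) (hq : ‖q‖ < 1) {α : Fin 6 → ℂ}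
    (hα : ∀ i, α i ≠ 0) (M : ℝ) : ∃ C, ∀ (n : ℤ) (ξ : ℂ), ξ ≠ 0 → ‖ξ‖ ≤ M → ‖ξ⁻¹‖ ≤ M →
      ‖vwpLattice q α ξ n‖ ≤ C * ‖q ^ 2 / ∏ i, α i‖ ^ n.natAbs := by
  obtain ⟨C, hC⟩ := norm_vwpLattice_le hq0 hq hα M
  refine ⟨C, fun n ξ hξ h1 h2 => ?_⟩
  obtain hn | hn := Int.natAbs_eq n
  · rw [hn, Int.natAbs_natCast]
    exact hC _ ξ hξ h1 h2
  · rw [hn, Int.natAbs_neg, Int.natAbs_natCast, ← norm_neg, ← vwpLattice_inv]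
    exact hC _ ξ⁻¹ (inv_ne_zero hξ) h2 (by rwa [inv_inv])

theorem summable_vwpLattice {q : ℂ} (hq0 : q ≠ 0) (hq : ‖q‖ < 1) {α : Fin 6 → ℂ}
    (hα : ∀ i, α i ≠ 0) (hw : ‖q ^ 2 / ∏ i, α i‖ < 1) {ξ : ℂ} (hξ : ξ ≠ 0) :
    Summable (vwpLattice q α ξ) := by
  obtain ⟨C, hC⟩ := exists_norm_vwpLattice_le hq0 hq hα (max ‖ξ‖ ‖ξ⁻¹‖)
  exact Summable.of_norm_bounded (summable_natAbs_pow (norm_nonneg _) hw C)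
    fun n => hC n ξ hξ (le_max_left _ _) (le_max_right _ _)

theorem differentiableAt_vwpLattice {q : ℂ} (hq0 : q ≠ 0) (hq : ‖q‖ < 1) {α : Fin 6 → ℂ}
    (hα : ∀ i, α i ≠ 0) (n : ℤ) {ξ : ℂ} (hξ : ξ ≠ 0) :
    DifferentiableAt ℂ (fun ξ => vwpLattice q α ξ n) ξ := by
  have hn : q ^ n ≠ 0 := zpow_ne_zero _ hq0
  have hu : ξ * q ^ n ≠ 0 := mul_ne_zero hξ hn
  unfold vwpLattice
  refine DifferentiableAt.mul (DifferentiableAt.mul ?_ (DifferentiableAt.fun_finsetProd fun i _ => ?_)) ?_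
  · exact DifferentiableAt.sub (DifferentiableAt.inv (by fun_prop) hu) (by fun_prop)
  · refine DifferentiableAt.mul ?_ ?_
    · exact ((differentiable_qInf hq) _).comp ξ (by fun_prop)
    · refine ((differentiable_qInf hq) _).comp ξ
        (DifferentiableAt.div (by fun_prop) (by fun_prop) (mul_ne_zero hu (hα i)))
  · exact (differentiableAt_zpow.mpr (Or.inl hξ)).const_mul _

theorem isOddTheta_vwpSum {q : ℂ} (hq0 : q ≠ 0) (hq : ‖q‖ < 1) {α : Fin 6 → ℂ}
    (hα : ∀ i, α i ≠ 0) (hw : ‖q ^ 2 / ∏ i, α i‖ < 1) : IsOddTheta q (vwpSum q α) where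
  map_q_mul ξ hξ := vwpSum_q_mul hq0 α hξ
  map_inv ξ _ := vwpSum_inv q α ξ
  differentiableOn := by
    intro x hx
    have hx : x ≠ 0 := hx
    obtain ⟨M, hM⟩ : ∃ M, max ‖x‖ ‖x⁻¹‖ < M := exists_gt _
    rw [max_lt_iff] at hM
    have hM0 : 0 < M := (norm_nonneg _).trans_lt hM.1
    let U : Set ℂ := {y | y ≠ 0 ∧ ‖y‖ < M ∧ M⁻¹ < ‖y‖}
    have hU : IsOpen U := isOpen_ne.inter ((isOpen_lt continuous_norm continuous_const).inter
      (isOpen_lt continuous_const continuous_norm))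
    have hxU : x ∈ U := ⟨hx, hM.1, by
      rw [norm_inv] at hM
      exact inv_lt_of_inv_lt₀ (norm_pos_iff.mpr hx) hM.2⟩
    obtain ⟨C, hC⟩ := exists_norm_vwpLattice_le hq0 hq hα M
    refine ((Complex.differentiableOn_tsum_of_summable_norm (U := U)
      (summable_natAbs_pow (norm_nonneg _) hw C) ?_ hU ?_).differentiableAt
      (hU.mem_nhds hxU)).differentiableWithinAt
    · exact fun n y hy => (differentiableAt_vwpLattice hq0 hq hα n hy.1).differentiableWithinAt
    · rintro n y ⟨hy0, hy1, hy2⟩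
      refine hC n y hy0 hy1.le ?_
      rw [norm_inv]
      exact inv_le_of_inv_le₀ hM0 hy2.le

/-! ### Theta products with a prescribed zero. -/

/-- The product `(y; q)_∞ (q / y; q)_∞`. -/
noncomputable def thetaProd (q y : ℂ) : ℂ := qInf q y * qInf q (q / y)

theorem thetaProd_q_mul {q y : ℂ} (hq0 : q ≠ 0) (hq : ‖q‖ < 1) (hy : y ≠ 0) :
    thetaProd q (q * y) = -y⁻¹ * thetaProd q y := by
  have e : q / (q * y) = y⁻¹ := by field_simp
  rw [thetaProd, thetaProd, e, qInf_succ hq y, qInf_succ hq y⁻¹, ← div_eq_mul_inv]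
  field_simp
  ring

theorem thetaProd_inv {q y : ℂ} (hq : ‖q‖ < 1) (hy : y ≠ 0) :
    thetaProd q y⁻¹ = -y⁻¹ * thetaProd q y := by
  rw [thetaProd, thetaProd, qInf_succ hq y, qInf_succ hq y⁻¹, ← div_eq_mul_inv, div_inv_eq_mul]
  field_simp
  ring

/-- A product of theta functions that vanishes at `t`. -/
noncomputable def vwpTheta (q t ξ : ℂ) : ℂ :=
  ξ⁻¹ * thetaProd q (ξ ^ 2) * (ξ⁻¹ * qTheta q (ξ * t) * qTheta q (ξ / t))

/-- The factor with `ξ ^ 2` is odd with multiplier `q⁻² ξ⁻⁴`; the factor with `t` is even with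
multiplier `q⁻¹ ξ⁻²`. -/
theorem isOddTheta_vwpTheta {q t : ℂ} (hq0 : q ≠ 0) (hq : ‖q‖ < 1) (ht : t ≠ 0) :
    IsOddTheta q (vwpTheta q t) where
  map_q_mul ξ hξ := by
    unfold vwpTheta
    rw [show (q * ξ) ^ 2 = q * (q * ξ ^ 2) by ring, thetaProd_q_mul hq0 hq (by positivity),
      thetaProd_q_mul hq0 hq (by positivity), mul_assoc q ξ t, mul_div_assoc,
      qTheta_q_mul hq0 (mul_ne_zero hξ ht), qTheta_q_mul hq0 (div_ne_zero hξ ht)]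
    field_simp
  map_inv ξ hξ := by
    unfold vwpTheta
    rw [show ξ⁻¹ ^ 2 = (ξ ^ 2)⁻¹ by rw [inv_pow], thetaProd_inv hq (by positivity),
      show ξ⁻¹ * t = (ξ / t)⁻¹ by field_simp, show ξ⁻¹ / t = (ξ * t)⁻¹ by field_simp,
      qTheta_inv (mul_ne_zero hξ ht), qTheta_inv (div_ne_zero hξ ht)]
    field_simp
  differentiableOn := by
    intro ξ hξ
    have hξ : ξ ≠ 0 := hξ
    have hθ : ∀ y : ℂ, y ≠ 0 → DifferentiableAt ℂ (qTheta q) y := fun y hy =>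
      (differentiableOn_qTheta hq0 hq).differentiableAt (isOpen_compl_singleton.mem_nhds hy)
    have hi : DifferentiableAt ℂ (fun ξ : ℂ => ξ⁻¹) ξ := differentiableAt_inv hξ
    refine DifferentiableAt.differentiableWithinAt ?_
    unfold vwpTheta thetaProd
    refine (hi.mul (DifferentiableAt.mul ?_ ?_)).mul ((hi.mul ?_).mul ?_)
    · exact (differentiable_qInf hq _).comp ξ (by fun_prop)
    · exact (differentiable_qInf hq _).comp ξ
        (DifferentiableAt.div (by fun_prop) (by fun_prop) (pow_ne_zero 2 hξ))
    · exact DifferentiableAt.comp (f := fun ξ => ξ * t) ξ (hθ _ (mul_ne_zero hξ ht)) (by fun_prop)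
    · exact DifferentiableAt.comp (f := fun ξ => ξ / t) ξ (hθ _ (div_ne_zero hξ ht)) (by fun_prop)

theorem qTheta_one (q : ℂ) : qTheta q 1 = 0 := by
  have := qTheta_inv (q := q) (x := 1) one_ne_zero
  rw [inv_one, neg_one_mul, self_eq_neg] at this
  exact this

theorem vwpTheta_self {q t : ℂ} (ht : t ≠ 0) : vwpTheta q t t = 0 := by
  rw [vwpTheta, div_self ht, qTheta_one, mul_zero, mul_zero]

/-! ### From the lattice sum to the bilateral series. -/

/-- The quotient telescopes. Taken at `y = √A` and `y = -√A`, it yields the very-well-poised factor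
`(1 - A q ^ (2 n)) / (1 - A)`. -/
theorem qPoch_q_mul {q y : ℂ} (h : ∀ j : ℕ, 1 - y * q ^ j ≠ 0)
    (h' : ∀ j : ℕ, 1 - q * y * (q ^ (j + 1))⁻¹ ≠ 0) (hq : q ≠ 0) (n : ℤ) :
    qPoch q (q * y) n / qPoch q y n = (1 - y * q ^ n) / (1 - y) := by
  have h1 (j : ℕ) : 1 - y * (q ^ (j + 1))⁻¹ ≠ 0 := by
    have := h' (j + 1)
    rw [pow_succ' q (j + 1), mul_inv] at this
    rwa [show q * y * (q⁻¹ * (q ^ (j + 1))⁻¹) = y * (q ^ (j + 1))⁻¹ by field_simp] at this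
  have h0 : 1 - y ≠ 0 := by simpa using h 0
  have hz (n : ℤ) : 1 - y * q ^ n ≠ 0 := by
    cases n with
    | ofNat n => simpa using h n
    | negSucc n => simpa [zpow_negSucc] using h1 n
  have hP : qPoch q y n ≠ 0 := by
    cases n with
    | ofNat n => exact prod_ne_zero_iff.mpr fun j _ => h j
    | negSucc n => exact inv_ne_zero (prod_ne_zero_iff.mpr fun j _ => h1 j)
  rw [div_eq_div_iff hP h0]
  have s1 (n : ℤ) := qPoch_succ (q := q) (y := y) n fun j _ => h1 j
  have s2 (n : ℤ) := qPoch_succ (q := q) (y := q * y) n fun j _ => h' j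
  clear hP
  induction n using Int.induction_on with
  | zero => simp [qPoch]
  | succ n ih =>
    rw [s1, s2, zpow_add_one₀ hq]
    linear_combination (1 - q * y * q ^ (n : ℤ)) * ih
  | pred n ih =>
    have e1 := s1 (-(n : ℤ) - 1)
    have e2 := s2 (-(n : ℤ) - 1)
    rw [sub_add_cancel] at e1 e2
    have e3 : q ^ (-(n : ℤ)) = q ^ (-(n : ℤ) - 1) * q := by rw [← zpow_add_one₀ hq, sub_add_cancel]
    rw [e1, e2, e3] at ih
    refine mul_left_cancel₀ (a := 1 - y * (q ^ (-(n : ℤ) - 1) * q)) ?_ ?_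
    · rw [← e3]; exact hz _
    · linear_combination ih

/-- The relation between the terms of the very-well-poised series and those of `vwpSum`. -/
theorem vwpLattice_eq_vwpPsiTerm {q : ℂ} (hq0 : q ≠ 0) (hq : ‖q‖ < 1) {α l : Fin 6 → ℂ}
    (hα : ∀ i, α i ≠ 0) {ξ A : ℂ} (hξ : ξ ≠ 0) (hA : A = ξ ^ 2) (hl : ∀ i, l i = ξ * α i)
    (hψ : VwpPsiDefined q A (List.ofFn l)) :
    1 - A ≠ 0 ∧ (∏ i, (qInf q (q / l i) * qInf q (A * q / l i))) ≠ 0 ∧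
    ∀ n, vwpLattice q α ξ n = ξ⁻¹ * (1 - A) * (∏ i, (qInf q (q / l i) * qInf q (A * q / l i))) *
      vwpPsiTerm q A (List.ofFn l) (q ^ 2 / ∏ i, α i) n := by
  -- The principal root `r` may be `-ξ`; only `r ^ 2 = A` is used.
  obtain ⟨r, hr⟩ : ∃ r, r = A ^ (1 / 2 : ℂ) := ⟨_, rfl⟩
  have hA0 : A ≠ 0 := by rw [hA]; positivity
  have hr2 : r ^ 2 = A := by
    rw [hr, one_div]
    exact Complex.cpow_ofNat_inv_pow A 2
  have hr0 : r ≠ 0 := by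
    rintro rfl
    exact hA0 (by rw [← hr2]; simp)
  have l1 : A * q / (q * r) = r := by rw [← hr2]; field_simp
  have l2 : A * q / -(q * r) = -r := by rw [← hr2]; field_simp
  have hl0 : ∀ i, l i ≠ 0 := fun i => by rw [hl]; exact mul_ne_zero hξ (hα i)
  have l3 : ∀ i, A * q / l i = ξ * q / α i := fun i => by
    have := hα i
    rw [hl, hA]; field_simp
  unfold VwpPsiDefined PsiDefined vwpLower vwpUpper at hψ
  rw [← hr] at hψ
  simp only [List.map_cons, l1, l2, List.forall_mem_cons, List.map_ofFn, List.forall_mem_ofFn_iff,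
    Function.comp_apply] at hψ
  obtain ⟨⟨u1, u2, u3⟩, v1, v2, v3⟩ := hψ
  -- The lower parameters paired with `±q r` are `±r`; their condition at `j = 0` excludes `r = ±1`.
  have hA1 : 1 - A ≠ 0 := by
    rw [← hr2, show 1 - r ^ 2 = (1 - r) * (1 - -r) by ring]
    exact mul_ne_zero (by simpa using v1 0) (by simpa using v2 0)
  refine ⟨hA1, prod_ne_zero_iff.mpr fun i _ => mul_ne_zero (qInf_ne_zero hq fun j hj => ?_)
    (qInf_ne_zero hq (v3 i)), fun n => ?_⟩
  -- A zero factor of `(q / l i; q)_∞` would mean `l i = q ^ (j + 1)`, which is excluded for upper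
  -- parameters.
  · refine u3 i j ?_
    have hli := hl0 i
    have hqj : q ^ (j + 1) ≠ 0 := pow_ne_zero _ hq0
    have e : q ^ (j + 1) = l i := by
      rw [sub_eq_zero, div_mul_eq_mul_div, eq_div_iff hli] at hj
      rw [pow_succ']
      linear_combination -hj
    rw [e, mul_inv_cancel₀ hli, sub_self]
  have w1 : qPoch q (q * r) n / qPoch q r n * (qPoch q (-(q * r)) n / qPoch q (-r) n) =
      (1 - A * q ^ (2 * n)) / (1 - A) := by
    rw [← mul_neg] at u2 ⊢
    have n1 : 1 - r ≠ 0 := by simpa using v1 0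
    have n2 : 1 - -r ≠ 0 := by simpa using v2 0
    have e5 : q ^ (2 * n) = (q ^ n) ^ 2 := by
      rw [← zpow_natCast, ← zpow_mul, mul_comm]
      rfl
    rw [qPoch_q_mul v1 u1 hq0, qPoch_q_mul v2 u2 hq0, ← hr2, div_mul_div_comm, e5]
    congr 1 <;> ring
  rw [vwpLattice_eq hq0 hq hα hξ n fun i j _ => by rw [← hl]; exact u3 i j, ← hA]
  unfold vwpPsiTerm psiTerm qPochList vwpLower vwpUpper
  rw [← hr]
  simp only [List.map_cons, l1, l2, List.map_ofFn, List.prod_cons, List.prod_ofFn,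
    Function.comp_apply]
  have w2 : ∀ i, qInf q (q ^ n * (ξ * q / α i)) * (qInf q (q / (ξ * α i)) * qPoch q (ξ * α i) n) =
      qInf q (q / l i) * qInf q (A * q / l i) * (qPoch q (l i) n / qPoch q (A * q / l i) n) := by
    intro i
    rw [← l3, ← hl, qInf_zpow_mul hq0 hq (v3 i)]
    ring
  simp only [w2]
  rw [prod_mul_distrib, prod_div_distrib]
  have w3 : ∀ a b c d e f : ℂ, a * (b * e) / (c * (d * f)) = a / c * (b / d) * (e / f) := by
    intros
    rw [div_mul_div_comm, div_mul_div_comm, mul_assoc, mul_assoc]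
  rw [w3, w1]
  field_simp

theorem summable_vwpPsiTerm_and_vwpSum_eq {q : ℂ} (hq0 : q ≠ 0) (hq : ‖q‖ < 1) {α l : Fin 6 → ℂ}
    (hα : ∀ i, α i ≠ 0) {ξ A w : ℂ} (hξ : ξ ≠ 0) (hA : A = ξ ^ 2) (hl : ∀ i, l i = ξ * α i)
    (hw : w = q ^ 2 / ∏ i, α i) (hw1 : ‖w‖ < 1) (hψ : VwpPsiDefined q A (List.ofFn l)) :
    1 - A ≠ 0 ∧ Summable (vwpPsiTerm q A (List.ofFn l) w) ∧
      vwpSum q α ξ = ξ⁻¹ * (1 - A) * (∏ i, (qInf q (q / l i) * qInf q (A * q / l i))) *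
        vwpPsi q A (List.ofFn l) w := by
  obtain ⟨h1, h2, h3⟩ := vwpLattice_eq_vwpPsiTerm hq0 hq hα hξ hA hl hψ
  rw [← hw] at h3
  refine ⟨h1, ?_, ?_⟩
  · have := summable_vwpLattice hq0 hq hα (hw ▸ hw1) hξ
    rw [funext h3] at this
    exact (summable_mul_left_iff (mul_ne_zero (mul_ne_zero (inv_ne_zero hξ) h1) h2)).mp this
  · rw [vwpSum, vwpPsi, ← tsum_mul_left]
    exact tsum_congr h3

/-- Isolates `ξ⁻¹ * (1 - ξ ^ 2)`, which also occurs in `vwpSum` and cancels in the interpolation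
formula. -/
theorem vwpTheta_eq {q : ℂ} (hq : ‖q‖ < 1) (t ξ : ℂ) :
    vwpTheta q t ξ = ξ⁻¹ * (1 - ξ ^ 2) * (qInf q (q * ξ ^ 2) * qInf q (q / ξ ^ 2)) *
      (ξ⁻¹ * qTheta q (ξ * t) * qTheta q (ξ / t)) := by
  rw [vwpTheta, thetaProd, qInf_succ hq (ξ ^ 2)]
  ring

/-! ### The three-term relation. -/

theorem mainTheorem5 (q a b c d e h k x z w : ℂ)
    (hq0 : 0 < ‖q‖) (hq1 : ‖q‖ < 1)
    (ha : a ≠ 0) (hb : b ≠ 0) (hc : c ≠ 0) (hd : d ≠ 0) (he : e ≠ 0) (hh : h ≠ 0) (hk : k ≠ 0)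
    (hx : x ≠ 0) (hz : z ≠ 0)
    -- the common argument of the three series
    (hw : w = a ^ 3 * q ^ 2 / (b * c * d * e * h * k)) (hw1 : ‖w‖ < 1)
    -- the terms of the three series are well defined
    (hψ₁ : VwpPsiDefined q a [b, c, d, e, h, k])
    (hψ₂ : VwpPsiDefined q (b ^ 2 * x ^ 2 / a)
      [b ^ 2 * x / a, b * c * x / a, b * d * x / a, b * e * x / a, b * h * x / a, b * k * x / a])
    (hψ₃ : VwpPsiDefined q (x ^ 2 * z ^ 2 / a)
      [b * x * z / a, c * x * z / a, d * x * z / a, e * x * z / a, h * x * z / a, k * x * z / a])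
    -- the denominators of the three coefficients do not vanish
    (hθ₁ : qThetaList q [b * x / a, x * z / a, b * x, x * z] ≠ 0)
    (hθ₂ : qThetaList q [z / b, b * x, b * x / a, b * x ^ 2 * z / a] ≠ 0)
    (hθ₃ : qThetaList q [b / z, x * z / a, b * x ^ 2 * z / a, x * z] ≠ 0)
    (hp₂ : qInfList q [b ^ 2 * x ^ 2 * q / a, a * q / (b ^ 2 * x ^ 2)] ≠ 0)
    (hp₃ : qInfList q [x ^ 2 * z ^ 2 * q / a, a * q / (x ^ 2 * z ^ 2)] ≠ 0) :
    Summable (vwpPsiTerm q a [b, c, d, e, h, k] w) ∧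
    Summable (vwpPsiTerm q (b ^ 2 * x ^ 2 / a)
      [b ^ 2 * x / a, b * c * x / a, b * d * x / a, b * e * x / a, b * h * x / a, b * k * x / a]
      w) ∧
    Summable (vwpPsiTerm q (x ^ 2 * z ^ 2 / a)
      [b * x * z / a, c * x * z / a, d * x * z / a, e * x * z / a, h * x * z / a, k * x * z / a]
      w) ∧
    qOmega q [q, a * q] [b, c, d, e, h, k] /
        qThetaList q [b * x / a, x * z / a, b * x, x * z] *
        vwpPsi q a [b, c, d, e, h, k] w =
      qInfList q [a * q, q / a] /
          qInfList q [b ^ 2 * x ^ 2 * q / a, a * q / (b ^ 2 * x ^ 2)] *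
          (qOmega q [a * q / (b * x), b * q * x] [b, c, d, e, h, k] /
            qThetaList q [z / b, b * x, b * x / a, b * x ^ 2 * z / a]) *
          vwpPsi q (b ^ 2 * x ^ 2 / a)
            [b ^ 2 * x / a, b * c * x / a, b * d * x / a, b * e * x / a, b * h * x / a,
              b * k * x / a] w +
        qInfList q [a * q, q / a] /
          qInfList q [x ^ 2 * z ^ 2 * q / a, a * q / (x ^ 2 * z ^ 2)] *
          (qOmega q [x * z * q, a * q / (x * z)] [b, c, d, e, h, k] /
            qThetaList q [b / z, x * z / a, b * x ^ 2 * z / a, x * z]) *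
          vwpPsi q (x ^ 2 * z ^ 2 / a)
            [b * x * z / a, c * x * z / a, d * x * z / a, e * x * z / a, h * x * z / a,
              k * x * z / a] w := by
  have hq : q ≠ 0 := norm_pos_iff.mp hq0
  obtain ⟨s, hs⟩ : ∃ s : ℂ, s ^ 2 = a := ⟨_, Complex.cpow_ofNat_inv_pow a 2⟩
  have hs0 : s ≠ 0 := by
    rintro rfl
    exact ha (by rw [← hs]; simp)
  let p : Fin 6 → ℂ := ![b, c, d, e, h, k]
  have hp : ∀ i, p i ≠ 0 := by
    intro i
    fin_cases i <;> assumption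
  let α : Fin 6 → ℂ := fun i => p i / s
  have hα : ∀ i, α i ≠ 0 := fun i => div_ne_zero (hp i) hs0
  have hwα : w = q ^ 2 / ∏ i, α i := by
    simp only [α, prod_div_distrib, prod_const, card_univ, Fintype.card_fin]
    rw [hw, ← hs]
    simp only [Fin.prod_univ_six, p, Matrix.cons_val]
    field_simp
  -- The nodes: their squares are the bases of the second and third series, and their products with
  -- the `α i` are the parameters.
  have hy₁ : b * x / s ≠ 0 := div_ne_zero (mul_ne_zero hb hx) hs0
  have hy₂ : x * z / s ≠ 0 := div_ne_zero (mul_ne_zero hx hz) hs0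
  have hA₂ : b ^ 2 * x ^ 2 / a = (b * x / s) ^ 2 := by rw [← hs]; ring
  have hA₃ : x ^ 2 * z ^ 2 / a = (x * z / s) ^ 2 := by rw [← hs]; ring
  have L₁ : [b, c, d, e, h, k] = List.ofFn fun i => p i := by simp [List.ofFn_succ, p]
  have L₂ : [b ^ 2 * x / a, b * c * x / a, b * d * x / a, b * e * x / a, b * h * x / a,
      b * k * x / a] = List.ofFn fun i => b * p i * x / a := by
    simp [List.ofFn_succ, p, sq]
  have L₃ : [b * x * z / a, c * x * z / a, d * x * z / a, e * x * z / a, h * x * z / a,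
      k * x * z / a] = List.ofFn fun i => p i * x * z / a := by
    simp [List.ofFn_succ, p]
  have hΩ (u v : ℂ) : qOmega q [u, v] [b, c, d, e, h, k] =
      ∏ i, (qInf q (u / p i) * qInf q (v / p i)) := by
    rw [L₁, qOmega, prod_mul_distrib]
    simp only [List.map_cons, List.map_nil, List.prod_cons, List.prod_nil, List.map_ofFn,
      List.prod_ofFn, Function.comp_apply, mul_one]
  simp only [hΩ]
  rw [L₂] at hψ₂
  rw [L₃] at hψ₃
  rw [L₁] at hψ₁
  rw [L₁, L₂, L₃]
  obtain ⟨n₁, S₁, E₁⟩ := summable_vwpPsiTerm_and_vwpSum_eq hq hq1 hα hs0 hs.symm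
    (fun i => by simp only [α]; field_simp) hwα hw1 hψ₁
  obtain ⟨n₂, S₂, E₂⟩ := summable_vwpPsiTerm_and_vwpSum_eq hq hq1 hα hy₁ hA₂
    (fun i => by simp only [α]; rw [← hs]; field_simp) hwα hw1 hψ₂
  obtain ⟨n₃, S₃, E₃⟩ := summable_vwpPsiTerm_and_vwpSum_eq hq hq1 hα hy₂ hA₃
    (fun i => by simp only [α]; rw [← hs]; field_simp) hwα hw1 hψ₃
  refine ⟨S₁, S₂, S₃, ?_⟩
  have hΩ₂ : (∏ i, (qInf q (q / (b * p i * x / a)) *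
      qInf q (b ^ 2 * x ^ 2 / a * q / (b * p i * x / a)))) =
      ∏ i, (qInf q (a * q / (b * x) / p i) * qInf q (b * q * x / p i)) :=
    prod_congr rfl fun i _ => by
      have := hp i
      congr 2 <;> field_simp
  have hΩ₃ : (∏ i, (qInf q (q / (p i * x * z / a)) *
      qInf q (x ^ 2 * z ^ 2 / a * q / (p i * x * z / a)))) =
      ∏ i, (qInf q (x * z * q / p i) * qInf q (a * q / (x * z) / p i)) :=
    prod_congr rfl fun i _ => by
      have := hp i
      rw [mul_comm]
      congr 2 <;> field_simp
  rw [hΩ₂] at E₂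
  rw [hΩ₃] at E₃
  have F11 := vwpTheta_self (q := q) hy₁
  have F22 := vwpTheta_self (q := q) hy₂
  have F12 := vwpTheta_eq hq1 (b * x / s) (x * z / s)
  have F21 := vwpTheta_eq hq1 (x * z / s) (b * x / s)
  have F1 := vwpTheta_eq hq1 (b * x / s) s
  have F2 := vwpTheta_eq hq1 (x * z / s) s
  have t1 : qTheta q (s / (b * x / s)) = -(b * x / a)⁻¹ * qTheta q (b * x / a) := by
    rw [← qTheta_inv (div_ne_zero (mul_ne_zero hb hx) ha), ← hs]
    congr 1
    field_simp
  have t2 : qTheta q (s / (x * z / s)) = -(x * z / a)⁻¹ * qTheta q (x * z / a) := by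
    rw [← qTheta_inv (div_ne_zero (mul_ne_zero hx hz) ha), ← hs]
    congr 1
    field_simp
  -- `θ(b / z)` and `θ(z / b)` both occur in the coefficients; one is eliminated so that they become
  -- a single unknown.
  have t7 : qTheta q (b / z) = -(z / b)⁻¹ * qTheta q (z / b) := by
    rw [← qTheta_inv (div_ne_zero hz hb), inv_div]
  rw [← hA₃, show x * z / s * (b * x / s) = b * x ^ 2 * z / a by rw [← hs]; field_simp,
    show x * z / s / (b * x / s) = z / b by field_simp] at F12
  rw [← hA₂, show b * x / s * (x * z / s) = b * x ^ 2 * z / a by rw [← hs]; field_simp,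
    show b * x / s / (x * z / s) = b / z by field_simp, t7] at F21
  rw [hs, show s * (b * x / s) = b * x by field_simp, t1] at F1
  rw [hs, show s * (x * z / s) = x * z by field_simp, t2] at F2
  simp only [qThetaList, qInfList, List.map_cons, List.map_nil, List.prod_cons, List.prod_nil,
    mul_one, t7] at hθ₁ hθ₂ hθ₃ hp₂ hp₃ ⊢
  rw [show q * (b ^ 2 * x ^ 2 / a) = b ^ 2 * x ^ 2 * q / a by ring,
    show q / (b ^ 2 * x ^ 2 / a) = a * q / (b ^ 2 * x ^ 2) by field_simp] at F21
  rw [show q * (x ^ 2 * z ^ 2 / a) = x ^ 2 * z ^ 2 * q / a by ring,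
    show q / (x ^ 2 * z ^ 2 / a) = a * q / (x ^ 2 * z ^ 2) by field_simp] at F12
  rw [mul_comm q a] at F1 F2
  simp only [mul_ne_zero_iff, ne_eq] at hθ₁ hθ₂ hp₂ hp₃
  obtain ⟨T1, T2, T3, T4⟩ := hθ₁
  obtain ⟨T6, -, -, T5⟩ := hθ₂
  have key := (isOddTheta_vwpSum hq hq1 hα (hwα ▸ hw1)).interpolation hq
    (isOddTheta_vwpTheta hq hq1 hy₁) (isOddTheta_vwpTheta hq hq1 hy₂) hs0 hy₁ hy₂ F11 F22
    (by
      rw [F12]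
      simp [hs0, hx, hz, n₃, hp₃.1, hp₃.2, T5, T6])
    (by
      rw [F21]
      simp [hs0, hx, hz, hb, n₂, hp₂.1, hp₂.2, T5, T6])
  rw [E₁, E₂, E₃, F12, F21, F1, F2] at key
  obtain ⟨N1, N2⟩ := hp₂
  obtain ⟨N3, N4⟩ := hp₃
  -- Only algebra is left: with all theta values, products and series as independent symbols, `key`
  -- is the claim up to nonzero factors.
  clear E₁ E₂ E₃ F12 F21 F1 F2 S₁ S₂ S₃ t1 t2 t7 F11 F22 hΩ hΩ₂ hΩ₃ L₁ L₂ L₃ hθ₃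
  generalize qTheta q (b * x / a) = θ₁ at *
  generalize qTheta q (x * z / a) = θ₂ at *
  generalize qTheta q (b * x) = θ₃ at *
  generalize qTheta q (x * z) = θ₄ at *
  generalize qTheta q (b * x ^ 2 * z / a) = θ₅ at *
  generalize qTheta q (z / b) = θ₆ at *
  generalize qInf q (b ^ 2 * x ^ 2 * q / a) = ν₁ at *
  generalize qInf q (a * q / (b ^ 2 * x ^ 2)) = ν₂ at *
  generalize qInf q (x ^ 2 * z ^ 2 * q / a) = ν₃ at *
  generalize qInf q (a * q / (x ^ 2 * z ^ 2)) = ν₄ at *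
  generalize 1 - b ^ 2 * x ^ 2 / a = A₂ at *
  generalize 1 - x ^ 2 * z ^ 2 / a = A₃ at *
  generalize 1 - a = A₁ at *
  generalize (∏ i, (qInf q (q / p i) * qInf q (a * q / p i))) = Ω₁ at *
  generalize (∏ i, (qInf q (a * q / (b * x) / p i) * qInf q (b * q * x / p i))) = Ω₂ at *
  generalize (∏ i, (qInf q (x * z * q / p i) * qInf q (a * q / (x * z) / p i))) = Ω₃ at *
  generalize vwpPsi _ _ _ _ = Ψ₁ at *
  generalize vwpPsi _ _ _ _ = Ψ₂ at *
  generalize vwpPsi _ _ _ _ = Ψ₃ at *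
  generalize qInf q (a * q) * qInf q (q / a) = N at *
  rw [← hs] at key
  field_simp at key ⊢
  linear_combination key
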